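/- Let $D$ be an integral domain with quotient field $K$. For a nonzero fractional ideal $I$ of $D$ put $I^{-1}=\{x\in K : xI\subseteq D\}$, $I_v=(I^{-1})^{-1}$, and $I_t=\bigcup J_v$, the union over all nonzero finitely generated fractional ideals $J\subseteq I$. A nonzero ideal $I$ of $D$ is a $t$-ideal if $I_t=I$, and is $t$-invertible if $(II^{-1})_t=D$; nonzero ideals $I,J$ are $t$-comaximal if $(I+J)_t=D$. A packet of $D$ is a $t$-invertible $t$-ideal of $D$ whose radical is prime. $D$ is a unique representation domain (URD) if every proper $t$-invertible $t$-ideal $I$ of $D$ can be written as $I=(I_1\cdots I_n)_t$ with pairwise $t$-comaximal packets $I_1,\dots,I_n$, uniquely up to order. $D$ is a GCD domain if $(a)\cap(b)$ is principal for all nonzero $a,b\in D$. An element $r\in D$ is rigid if it is a nonzero nonunit and, for all $s,t\in D$ dividing $r$, $s\mid t$ or $t\mid s$. $D$ is a generalized UFD (GUFD) if it is a GCD domain in which every nonzero nonunit is a finite product of rigid elements and in which, for every rigid $r$ and every nonunit factor $s$ of $r$, $r\mid s^n$ for some $n\ge 1$. **Theorem 4.5.** For a GCD domain $D$ that is also a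 URD, the following are equivalent. 1. $D$ is an intersection of rank-one valuation domains, that is, the intersection of a family (empty if $D=K$) of valuation rings of $K$ of Krull dimension one. 2. $D$ is completely integrally closed: if $x\in K$, $0\ne r\in D$ and $rx^n\in D$ for all $n\ge1$, then $x\in D$. 3. $D[[X]]$ is integrally closed. 4. $D$ is Archimedean: $\bigcap_{n\ge1}(x^n)=(0)$ for every nonunit $x\in D$. 5. Every packet of $D$ is contained in a height-one prime ideal of $D$. 6. $D$ is a GUFD. -/

import Mathlib

open scoped nonZeroDivisors

noncomputable section

namespace GCDURD

variable {D : Type*} [CommRing D] [IsDomain D]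
variable {K : Type*} [Field K] [Algebra D K] [IsFractionRing D K]

/-- `I_v = (I⁻¹)⁻¹`, where `I⁻¹ = (D :_K I)` (and `(0)⁻¹ = (0)`, so that `(0)_v = (0)`). -/
def vClosure (I : FractionalIdeal D⁰ K) : FractionalIdeal D⁰ K := (I⁻¹)⁻¹

theorem vClosure_mono {I J : FractionalIdeal D⁰ K} (h : I ≤ J) : vClosure I ≤ vClosure J := by
  by_cases hI : I = 0
  · subst hI
    simp [vClosure, FractionalIdeal.inv_zero']
  have hJ : J ≠ 0 := by
    rintro rfl
    exact hI (le_antisymm h (FractionalIdeal.zero_le I))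
  have ne : ∀ A : FractionalIdeal D⁰ K, A ≠ 0 → A⁻¹ ≠ 0 := fun A hA => by
    obtain ⟨a, ha, hmem⟩ := A.2
    have ha0 : algebraMap D K a ≠ 0 := by
      simpa using nonZeroDivisors.ne_zero ha
    have : algebraMap D K a ∈ A⁻¹ := by
      rw [FractionalIdeal.mem_inv_iff hA]
      intro y hy
      obtain ⟨c, hc⟩ := hmem y hy
      rw [FractionalIdeal.mem_one_iff]
      exact ⟨c, by rw [hc, Algebra.smul_def]⟩
    intro h0
    rw [h0, FractionalIdeal.mem_zero_iff] at this
    exact ha0 this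
  exact FractionalIdeal.inv_anti_mono (ne J hJ) (ne I hI) (FractionalIdeal.inv_anti_mono hI hJ h)

/-- `I_t`, the union of the `J_v` over all finitely generated fractional ideals `J ⊆ I`. -/
def tClosure (I : FractionalIdeal D⁰ K) : FractionalIdeal D⁰ K :=
  ⟨{ carrier := {x | ∃ J : FractionalIdeal D⁰ K,
        J ≤ I ∧ (J : Submodule D K).FG ∧ x ∈ vClosure J}
     zero_mem' := ⟨0, FractionalIdeal.zero_le I, by
        simpa using (Submodule.fg_bot : (⊥ : Submodule D K).FG), FractionalIdeal.zero_mem _⟩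
     add_mem' := by
        rintro x y ⟨A, hA, fA, hx⟩ ⟨B, hB, fB, hy⟩
        refine ⟨A ⊔ B, sup_le hA hB, ?_, ?_⟩
        · rw [FractionalIdeal.coe_sup]
          exact fA.sup fB
        · exact (vClosure (A ⊔ B) : Submodule D K).add_mem
            (vClosure_mono le_sup_left hx) (vClosure_mono le_sup_right hy)
     smul_mem' := by
        rintro c x ⟨A, hA, fA, hx⟩
        exact ⟨A, hA, fA, (vClosure A : Submodule D K).smul_mem c hx⟩ },
   FractionalIdeal.isFractional_of_le (J := vClosure I) (by
      rintro x ⟨A, hA, -, hx⟩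
      exact vClosure_mono hA hx)⟩

/-- `I` is a `t`-ideal of `D`: `I_t = I`. -/
def IsTIdeal (K : Type*) [Field K] [Algebra D K] [IsFractionRing D K] (I : Ideal D) : Prop :=
  tClosure (I : FractionalIdeal D⁰ K) = (I : FractionalIdeal D⁰ K)

/-- `I` is `t`-invertible: `(I I⁻¹)_t = D`. The zero ideal is not `t`-invertible. -/
def IsTInvertible (K : Type*) [Field K] [Algebra D K] [IsFractionRing D K] (I : Ideal D) : Prop :=
  tClosure ((I : FractionalIdeal D⁰ K) * (I : FractionalIdeal D⁰ K)⁻¹) = 1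

/-- `I` and `J` are `t`-comaximal: `(I + J)_t = D`. -/
def TComaximal (K : Type*) [Field K] [Algebra D K] [IsFractionRing D K] (I J : Ideal D) : Prop :=
  tClosure ((I : FractionalIdeal D⁰ K) + (J : FractionalIdeal D⁰ K)) = 1

/-- A packet of `D`: a `t`-invertible `t`-ideal with prime radical. -/
structure IsPacket (K : Type*) [Field K] [Algebra D K] [IsFractionRing D K] (I : Ideal D) :
    Prop where
  isTIdeal : IsTIdeal K I
  isTInvertible : IsTInvertible K I
  radical_isPrime : I.radical.IsPrime

/-- Unique representation domain: every proper `t`-invertible `t`-ideal `I` is uniquely a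
`t`-product `(I₁ ⋯ Iₙ)_t` of pairwise `t`-comaximal packets, up to order. The packets form a
finite set rather than a multiset: pairwise `t`-comaximal packets are distinct, because
a packet, being a proper `t`-ideal, is not `t`-comaximal with itself. -/
def IsURD (D : Type*) [CommRing D] [IsDomain D]
    (K : Type*) [Field K] [Algebra D K] [IsFractionRing D K] : Prop :=
  ∀ I : Ideal D, I ≠ ⊤ → IsTIdeal K I → IsTInvertible K I →
    ∃! s : Finset (Ideal D),
      (∀ J ∈ s, IsPacket K J) ∧ (s : Set (Ideal D)).Pairwise (TComaximal K) ∧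
      tClosure (∏ J ∈ s, (J : FractionalIdeal D⁰ K)) = (I : FractionalIdeal D⁰ K)

/-- Every element of the quotient field `K` that is almost integral over `D` lies in `D`. -/
def IsCompletelyIntegrallyClosed (D : Type*) [CommRing D] [IsDomain D]
    (K : Type*) [Field K] [Algebra D K] [IsFractionRing D K] : Prop :=
  ∀ x : K, IsAlmostIntegral D x → x ∈ (algebraMap D K).range

/-- `D` is the intersection, inside its quotient field `K`, of a (possibly empty) family of
valuation rings of `K` of rank (= Krull dimension) one; the empty intersection is `K`. -/
def IsIntersectionOfRankOneValuationDomains (D : Type*) [CommRing D] [IsDomain D]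
    (K : Type*) [Field K] [Algebra D K] [IsFractionRing D K] : Prop :=
  ∃ S : Set (ValuationSubring K), (∀ V ∈ S, ringKrullDim V = 1) ∧
    ∀ x : K, x ∈ (algebraMap D K).range ↔ ∀ V ∈ S, x ∈ V

/-- `⋂ₙ (xⁿ) = (0)`, over `n ≥ 1`, for every nonunit `x`. -/
def IsArchimedean (D : Type*) [CommRing D] [IsDomain D] : Prop :=
  ∀ x : D, ¬ IsUnit x → ⨅ n : ℕ, Ideal.span {x ^ (n + 1)} = (⊥ : Ideal D)

/-- A rigid element: a nonzero nonunit whose factors are totally ordered by divisibility. -/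
def IsRigid (r : D) : Prop :=
  r ≠ 0 ∧ ¬ IsUnit r ∧ ∀ s t : D, s ∣ r → t ∣ r → s ∣ t ∨ t ∣ s

/-- Generalized unique factorization domain. -/
structure IsGUFD (D : Type*) [CommRing D] [IsDomain D] : Prop where
  isGCDMonoid : IsGCDMonoid D
  exists_rigid_factorization : ∀ x : D, x ≠ 0 → ¬ IsUnit x →
    ∃ l : Multiset D, (∀ r ∈ l, IsRigid r) ∧ l.prod = x
  dvd_pow_of_rigid : ∀ r : D, IsRigid r → ∀ s : D, s ∣ r → ¬ IsUnit s →
    ∃ n : ℕ, 1 ≤ n ∧ r ∣ s ^ n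

end GCDURD

end

noncomputable section

open scoped Pointwise

namespace GCDURD

/-! ### The `t`-operation, and `t`-invertible `t`-ideals of a GCD domain. -/

section TClosure

variable {D : Type*} [CommRing D] [IsDomain D]
variable {K : Type*} [Field K] [Algebra D K] [IsFractionRing D K]

/-! In a GCD domain packets are the principal ideals `(p)`, `p ≠ 0`, with prime radical, and the URD
property factors every nonzero nonunit into such `p`. Since `√(p)` is closed under gcds, two coprime
elements never both lie in it (`IsPacketGenerator.not_isUnit_gcd`); hence the localization at `√(p)`
is a valuation ring.

All the conditions amount to every `√(p)` having height one. In that case the localizations have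
rank one and intersect in `D`, and the `p` are rigid. Conversely, GUFD forces height one by
comparing rigid factors, and the Archimedean property does so because every power of `p` divides
each element of a prime strictly below `√(p)`.

Between complete integral closure and the Archimedean property, one direction through `D⟦X⟧`
compares lowest coefficients, the other uses a root of `T² - aT + X` whose coefficients involve
Catalan numbers. -/

theorem mem_tClosure {I : FractionalIdeal D⁰ K} {x : K} :
    x ∈ tClosure I ↔ ∃ J : FractionalIdeal D⁰ K,
      J ≤ I ∧ (J : Submodule D K).FG ∧ x ∈ vClosure J :=
  Iff.rfl

theorem vClosure_spanSingleton (x : K) :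
    vClosure (FractionalIdeal.spanSingleton D⁰ x) = FractionalIdeal.spanSingleton D⁰ x := by
  rw [vClosure, FractionalIdeal.spanSingleton_inv, FractionalIdeal.spanSingleton_inv, inv_inv]

theorem tClosure_spanSingleton (x : K) :
    tClosure (FractionalIdeal.spanSingleton D⁰ x) = FractionalIdeal.spanSingleton D⁰ x := by
  apply le_antisymm
  · rintro y ⟨J, hJ, -, hy⟩
    rw [← vClosure_spanSingleton (D := D)]
    exact vClosure_mono hJ hy
  · intro y hy
    refine mem_tClosure.2 ⟨_, le_rfl, ?_, (vClosure_spanSingleton (D := D) x).symm ▸ hy⟩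
    rw [FractionalIdeal.coe_spanSingleton]
    exact Submodule.fg_span_singleton x

theorem isTIdeal_span_singleton (x : D) : IsTIdeal K (Ideal.span {x}) := by
  rw [IsTIdeal, FractionalIdeal.coeIdeal_span_singleton, tClosure_spanSingleton]

theorem isTInvertible_span_singleton {x : D} (hx : x ≠ 0) : IsTInvertible K (Ideal.span {x}) := by
  have hx' : algebraMap D K x ≠ 0 := by simpa using hx
  rw [IsTInvertible, FractionalIdeal.coeIdeal_span_singleton,
    FractionalIdeal.spanSingleton_mul_inv K hx', ← FractionalIdeal.spanSingleton_one,
    tClosure_spanSingleton]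

theorem tClosure_zero : tClosure (0 : FractionalIdeal D⁰ K) = 0 := by
  simpa using tClosure_spanSingleton (D := D) (0 : K)

theorem IsTInvertible.ne_bot {I : Ideal D} (h : IsTInvertible K I) : I ≠ ⊥ := by
  rintro rfl
  rw [IsTInvertible, FractionalIdeal.coeIdeal_bot, zero_mul, tClosure_zero] at h
  exact zero_ne_one h

/-- In a GCD domain, a finite set `s` has a common divisor `d` such that `s` and `d` have the same
multipliers into `D`. -/
theorem exists_gcd_finset [GCDMonoid D] (s : Finset D) :
    ∃ d : D, (∀ a ∈ s, d ∣ a) ∧ ∀ z : K, (∀ a ∈ s, ∃ c, algebraMap D K c = z * algebraMap D K a) →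
      ∃ c, algebraMap D K c = z * algebraMap D K d := by
  classical
  induction s using Finset.induction_on with
  | empty => exact ⟨0, by simp, fun z _ => ⟨0, by simp⟩⟩
  | insert a s _ ih =>
    obtain ⟨d, hd, hz⟩ := ih
    refine ⟨gcd a d, ?_, ?_⟩
    · intro b hb
      rcases Finset.mem_insert.1 hb with rfl | hb
      · exact gcd_dvd_left _ _
      · exact (gcd_dvd_right _ _).trans (hd b hb)
    · intro z h
      obtain ⟨c₁, h₁⟩ := h a (Finset.mem_insert_self _ _)
      obtain ⟨c₂, h₂⟩ := hz z fun b hb => h b (Finset.mem_insert_of_mem hb)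
      obtain ⟨m, n, hn, rfl⟩ := IsFractionRing.div_surjective D z
      have hn0 : algebraMap D K n ≠ 0 := by simpa using nonZeroDivisors.ne_zero hn
      -- With `z = m / n`, the condition `z * b ∈ D` means `n ∣ m * b`, and gcd commutes with
      -- multiplication by `m`.
      have key : ∀ c b : D, algebraMap D K c = algebraMap D K m / algebraMap D K n *
          algebraMap D K b → n ∣ m * b := fun c b h => by
        refine ⟨c, IsFractionRing.injective D K ?_⟩
        rw [map_mul, map_mul, h]
        field_simp
      obtain ⟨e, he⟩ := (dvd_gcd (key _ _ h₁) (key _ _ h₂)).trans (gcd_mul_left' m a d).dvd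
      refine ⟨e, ?_⟩
      have := congrArg (algebraMap D K) he
      rw [map_mul, map_mul] at this
      field_simp
      rw [mul_comm, ← this]

/-- In a GCD domain, `t`-invertible `t`-ideals are principal. -/
theorem exists_eq_span_singleton [GCDMonoid D] {I : Ideal D} (hI : IsTIdeal K I)
    (hI' : IsTInvertible K I) : ∃ d : D, d ≠ 0 ∧ I = Ideal.span {d} := by
  classical
  have hI0 := hI'.ne_bot
  have hIK : (I : FractionalIdeal D⁰ K) ≠ 0 := FractionalIdeal.coeIdeal_ne_zero.2 hI0
  obtain ⟨J, hJ, ⟨T, hT⟩, h1⟩ : ∃ J : FractionalIdeal D⁰ K,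
      J ≤ (I : FractionalIdeal D⁰ K) * (I : FractionalIdeal D⁰ K)⁻¹ ∧
      (J : Submodule D K).FG ∧ (1 : K) ∈ vClosure J :=
    mem_tClosure.1 (by rw [show tClosure _ = 1 from hI']; exact FractionalIdeal.one_mem_one D⁰)
  have hJ0 : J ≠ 0 := by
    rintro rfl
    simp [vClosure, FractionalIdeal.inv_zero'] at h1
  obtain ⟨x, hx, hx0⟩ := Submodule.exists_mem_ne_zero_of_ne_bot hI0
  -- Each generator of `J` is a finite sum of products from `I` and `I⁻¹`; `s` collects the factors
  -- from `I`. The nonzero `x` is included so that the gcd of `s` is nonzero.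
  have hfin : ∃ s : Finset D, x ∈ s ∧ (s : Set D) ⊆ I ∧ ∀ w : K,
      (∀ a ∈ s, ∀ z ∈ (I : FractionalIdeal D⁰ K)⁻¹,
        w * (algebraMap D K a * z) ∈ (1 : FractionalIdeal D⁰ K)) →
      ∀ t ∈ T, w * t ∈ (1 : FractionalIdeal D⁰ K) := by
    have hTI : ∀ t ∈ T, t ∈ (I : FractionalIdeal D⁰ K) * (I : FractionalIdeal D⁰ K)⁻¹ :=
      fun t ht => hJ (show t ∈ (J : Submodule D K) from hT ▸ Submodule.subset_span ht)
    clear hT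
    induction T using Finset.induction_on with
    | empty => exact ⟨{x}, by simp, by simpa using hx, by simp⟩
    | insert t T _ ih =>
      obtain ⟨s, hxs, hs, h⟩ := ih fun t ht => hTI t (Finset.mem_insert_of_mem ht)
      obtain ⟨A, B, hA, hB, ht⟩ :=
        FractionalIdeal.mem_span_mul_finite_of_mem_mul (hTI t (Finset.mem_insert_self _ _))
      have hA' : ∀ a ∈ A, ∃ b ∈ I, algebraMap D K b = a := fun a ha => by
        simpa [FractionalIdeal.mem_coeIdeal] using hA ha
      choose! f hf hf' using hA'
      refine ⟨A.image f ∪ s, Finset.mem_union_right _ hxs, ?_, ?_⟩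
      · intro b hb
        rcases Finset.mem_union.1 hb with hb | hb
        · obtain ⟨a, ha, rfl⟩ := Finset.mem_image.1 hb
          exact hf a ha
        · exact hs hb
      · intro w hw t' ht'
        rcases Finset.mem_insert.1 ht' with rfl | ht'
        · have : Submodule.span D ((A : Set K) * (B : Set K)) ≤
              ((1 : FractionalIdeal D⁰ K) : Submodule D K).comap (LinearMap.mulLeft D w) := by
            rw [Submodule.span_le]
            rintro _ ⟨a, ha, b, hb, rfl⟩
            have := hw (f a) (Finset.mem_union_left _ (Finset.mem_image_of_mem f ha)) b (hB hb)
            rwa [hf' a ha] at this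
          exact this ht
        · exact h w (fun a ha => hw a (Finset.mem_union_right _ ha)) t' ht'
  obtain ⟨s, hxs, hs, hw⟩ := hfin
  obtain ⟨d, hd, hz⟩ := exists_gcd_finset (K := K) s
  have hd0 : d ≠ 0 := by
    rintro rfl
    exact hx0 (zero_dvd_iff.1 (hd x hxs))
  have hdK : algebraMap D K d ≠ 0 := by simpa using hd0
  refine ⟨d, hd0, le_antisymm ?_ ?_⟩
  -- `y / d` sends `s * I⁻¹` into `D`, so it lies in `J⁻¹`; as `1 ∈ J_v`, it lies in `D`.
  · intro y hy
    have hwJ : algebraMap D K y / algebraMap D K d ∈ J⁻¹ := by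
      rw [FractionalIdeal.mem_inv_iff hJ0]
      have hle : (J : Submodule D K) ≤ ((1 : FractionalIdeal D⁰ K) : Submodule D K).comap
          (LinearMap.mulLeft D (algebraMap D K y / algebraMap D K d)) := by
        rw [← hT, Submodule.span_le]
        refine hw _ fun a ha z hz => ?_
        obtain ⟨b, rfl⟩ := hd a ha
        obtain ⟨c, hc⟩ := (FractionalIdeal.mem_one_iff D⁰).1
          ((FractionalIdeal.mem_inv_iff hIK).1 hz _ (FractionalIdeal.mem_coeIdeal_of_mem D⁰ hy))
        refine (FractionalIdeal.mem_one_iff D⁰).2 ⟨b * c, ?_⟩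
        rw [map_mul, map_mul, hc]
        field_simp
      exact fun t ht => hle ht
    have hJ1 : J⁻¹ ≠ 0 := by
      intro h
      rw [vClosure, h, FractionalIdeal.inv_zero'] at h1
      simp at h1
    obtain ⟨c, hc⟩ := (FractionalIdeal.mem_one_iff D⁰).1
      ((FractionalIdeal.mem_inv_iff hJ1).1 h1 _ hwJ)
    rw [Ideal.mem_span_singleton]
    refine ⟨c, IsFractionRing.injective D K ?_⟩
    rw [map_mul, hc]
    field_simp
  -- The gcd `d` lies in `(s)_v ⊆ I_t = I`.
  · have hx' : x ∈ Ideal.span (s : Set D) := Ideal.subset_span hxs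
    have hs0 : (Ideal.span (s : Set D) : FractionalIdeal D⁰ K) ≠ 0 := by
      rw [FractionalIdeal.coeIdeal_ne_zero]
      rintro h
      rw [h] at hx'
      exact hx0 hx'
    have hs1 : (Ideal.span (s : Set D) : FractionalIdeal D⁰ K)⁻¹ ≠ 0 := by
      intro h
      have h1 : (1 : K) ∈ (Ideal.span (s : Set D) : FractionalIdeal D⁰ K)⁻¹ :=
        (FractionalIdeal.mem_inv_iff hs0).2 fun y hy => by
          rw [one_mul]
          exact FractionalIdeal.coeIdeal_le_one hy
      rw [h, FractionalIdeal.mem_zero_iff] at h1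
      exact one_ne_zero h1
    have hdI : algebraMap D K d ∈ (I : FractionalIdeal D⁰ K) := by
      rw [← show tClosure _ = _ from hI]
      refine mem_tClosure.2 ⟨(Ideal.span (s : Set D) : Ideal D),
        (FractionalIdeal.coeIdeal_le_coeIdeal K).2 (Ideal.span_le.2 hs), ?_, ?_⟩
      · exact (FractionalIdeal.coeIdeal_fg D⁰ (IsFractionRing.injective D K) _).2 ⟨s, rfl⟩
      · refine (FractionalIdeal.mem_inv_iff hs1).2 fun z hz' => ?_
        rw [mul_comm, FractionalIdeal.mem_one_iff]
        exact hz z fun a ha => (FractionalIdeal.mem_one_iff D⁰).1 <|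
          (FractionalIdeal.mem_inv_iff hs0).1 hz' _
            (FractionalIdeal.mem_coeIdeal_of_mem D⁰ (Ideal.subset_span ha))
    obtain ⟨e, he, hed⟩ := (FractionalIdeal.mem_coeIdeal D⁰).1 hdI
    rw [Ideal.span_singleton_le_iff_mem, ← IsFractionRing.injective D K hed]
    exact he

end TClosure

/-! ### Packet generators and factorization into them. -/

section Packet

variable {D : Type*} [CommRing D]

/-- A nonzero element `p` such that the radical of `(p)` is prime. -/
def IsPacketGenerator (p : D) : Prop :=
  p ≠ 0 ∧ (Ideal.span {p}).radical.IsPrime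

theorem mem_radical_span_singleton {p y : D} :
    y ∈ (Ideal.span {p}).radical ↔ ∃ n : ℕ, p ∣ y ^ n := by
  simp [Ideal.mem_radical_iff, Ideal.mem_span_singleton]

theorem self_mem_radical_span_singleton (p : D) : p ∈ (Ideal.span {p}).radical :=
  Ideal.le_radical (Ideal.mem_span_singleton_self p)

theorem radical_span_singleton_le {p : D} {Q : Ideal D} (hQ : Q.IsPrime) (h : p ∈ Q) :
    (Ideal.span {p}).radical ≤ Q :=
  hQ.radical_le_iff.2 ((Ideal.span_singleton_le_iff_mem Q).2 h)

namespace IsPacketGenerator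

variable {p q : D}

theorem ne_zero (hp : IsPacketGenerator p) : p ≠ 0 := hp.1

theorem isPrime (hp : IsPacketGenerator p) : (Ideal.span {p}).radical.IsPrime := hp.2

theorem not_isUnit (hp : IsPacketGenerator p) : ¬ IsUnit p := fun h =>
  hp.isPrime.ne_top (Ideal.eq_top_of_isUnit_mem _ (self_mem_radical_span_singleton p) h)

theorem radical_ne_bot (hp : IsPacketGenerator p) : (Ideal.span {p}).radical ≠ ⊥ := by
  intro h
  have := self_mem_radical_span_singleton p
  rw [h] at this
  exact hp.ne_zero this

theorem of_associated [IsDomain D] (hp : IsPacketGenerator p) (h : Associated p q) : IsPacketGenerator q :=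
  ⟨h.ne_zero_iff.1 hp.ne_zero, by
    rw [← Ideal.span_singleton_eq_span_singleton.2 h]
    exact hp.isPrime⟩

theorem isPacket [IsDomain D] (K : Type*) [Field K] [Algebra D K] [IsFractionRing D K]
    (hp : IsPacketGenerator p) : IsPacket K (Ideal.span {p}) :=
  ⟨isTIdeal_span_singleton p, isTInvertible_span_singleton hp.ne_zero, hp.isPrime⟩

end IsPacketGenerator

theorem IsPacket.exists_eq_span_singleton [IsDomain D] {K : Type*} [Field K] [Algebra D K] [IsFractionRing D K]
    [GCDMonoid D] {I : Ideal D} (hI : IsPacket K I) :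
    ∃ p : D, IsPacketGenerator p ∧ I = Ideal.span {p} := by
  obtain ⟨p, hp, rfl⟩ := GCDURD.exists_eq_span_singleton hI.isTIdeal hI.isTInvertible
  exact ⟨p, ⟨hp, hI.radical_isPrime⟩, rfl⟩

/-- The unit is absorbed into one factor; there is one because `x` is a nonunit. -/
theorem exists_multiset_prod_eq {P : D → Prop} (hP : ∀ a b, P a → Associated a b → P b)
    {x : D} (hx : ¬ IsUnit x) {l : Multiset D} (hl : ∀ a ∈ l, P a) (h : Associated l.prod x) :
    ∃ l : Multiset D, (∀ a ∈ l, P a) ∧ l.prod = x := by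
  induction l using Multiset.induction_on with
  | empty => exact absurd (h.isUnit (by simp)) hx
  | cons a l _ =>
    obtain ⟨u, rfl⟩ := h
    refine ⟨(a * u) ::ₘ l, fun b hb => ?_, by rw [Multiset.prod_cons, Multiset.prod_cons]; ring⟩
    rcases Multiset.mem_cons.1 hb with rfl | hb
    · exact hP a _ (hl a (Multiset.mem_cons_self a l)) ⟨u, rfl⟩
    · exact hl b (Multiset.mem_cons_of_mem hb)

theorem exists_isPacketGenerator_dvd
    (hfac : ∀ x : D, x ≠ 0 → ¬ IsUnit x →
      ∃ l : Multiset D, (∀ p ∈ l, IsPacketGenerator p) ∧ l.prod = x)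
    {x : D} (hx : x ≠ 0) (hx' : ¬ IsUnit x) : ∃ p, IsPacketGenerator p ∧ p ∣ x := by
  obtain ⟨l, hl, rfl⟩ := hfac x hx hx'
  obtain ⟨p, hp⟩ := Multiset.exists_mem_of_ne_zero (s := l) (by
    rintro rfl
    simp at hx')
  exact ⟨p, hl p hp, Multiset.dvd_prod hp⟩

/-- If `p` divides `a ^ m` and `b ^ n`, it divides their gcd, which divides a power of `gcd a b`. -/
theorem gcd_mem_radical_span_singleton [GCDMonoid D] {p a b : D}
    (ha : a ∈ (Ideal.span {p}).radical) (hb : b ∈ (Ideal.span {p}).radical) :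
    gcd a b ∈ (Ideal.span {p}).radical := by
  rw [mem_radical_span_singleton] at *
  obtain ⟨m, hm⟩ := ha
  obtain ⟨n, hn⟩ := hb
  refine ⟨n * m, ?_⟩
  rw [pow_mul]
  exact (dvd_gcd hm hn).trans <| gcd_pow_left_dvd_pow_gcd.trans <|
    pow_dvd_pow_of_dvd gcd_pow_right_dvd_pow_gcd m

theorem IsPacketGenerator.not_isUnit_gcd [GCDMonoid D] {p a b : D} (hp : IsPacketGenerator p)
    (ha : a ∈ (Ideal.span {p}).radical) (hb : b ∈ (Ideal.span {p}).radical) :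
    ¬ IsUnit (gcd a b) := fun h =>
  hp.isPrime.ne_top (Ideal.eq_top_of_isUnit_mem _ (gcd_mem_radical_span_singleton ha hb) h)

variable [IsDomain D]

/-- In a GCD unique representation domain, nonzero nonunits are products of generators of
packets. -/
theorem IsURD.exists_multiset_isPacketGenerator {K : Type*} [Field K] [Algebra D K]
    [IsFractionRing D K] [GCDMonoid D] (h : IsURD D K) {x : D} (hx : x ≠ 0) (hx' : ¬ IsUnit x) :
    ∃ l : Multiset D, (∀ p ∈ l, IsPacketGenerator p) ∧ l.prod = x := by
  obtain ⟨s, ⟨hs, -, hprod⟩, -⟩ := h (Ideal.span {x}) (by rwa [Ne, Ideal.span_singleton_eq_top])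
    (isTIdeal_span_singleton x) (isTInvertible_span_singleton hx)
  have hs' : ∀ J ∈ s, ∃ p : D, IsPacketGenerator p ∧ J = Ideal.span {p} := fun J hJ =>
    (hs J hJ).exists_eq_span_singleton
  choose! f hf hf' using hs'
  refine exists_multiset_prod_eq (fun a b => IsPacketGenerator.of_associated) hx'
    (l := s.val.map f) ?_ ?_
  · intro p hp
    obtain ⟨J, hJ, rfl⟩ := Multiset.mem_map.1 hp
    exact hf J hJ
  · rw [show (s.val.map f).prod = ∏ J ∈ s, f J from rfl,
      ← Ideal.span_singleton_eq_span_singleton, ← FractionalIdeal.coeIdeal_inj (K := K), ← hprod]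
    have : ∏ J ∈ s, (J : FractionalIdeal D⁰ K) =
        FractionalIdeal.spanSingleton D⁰ (algebraMap D K (∏ J ∈ s, f J)) := by
      rw [← FractionalIdeal.coeIdeal_span_singleton, ← Ideal.prod_span_singleton,
        ← FractionalIdeal.coeIdealHom_apply, map_prod]
      exact Finset.prod_congr rfl fun J hJ => by
        rw [FractionalIdeal.coeIdealHom_apply, ← hf' J hJ]
    rw [this, tClosure_spanSingleton, FractionalIdeal.coeIdeal_span_singleton]

end Packet

/-! ### Integral closedness of the power series ring. -/

section PowerSeries

open PowerSeries

variable {D : Type*} [CommRing D] [IsDomain D]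

/-- The lowest coefficient is multiplicative, so that of `r` is a common denominator for the powers
of that of `u`. -/
theorem isAlmostIntegral_constantCoeff_divXPowOrder
    {K : Type*} [Field K] [Algebra D K] [IsFractionRing D K] {u : K⟦X⟧}
    (h : IsAlmostIntegral D⟦X⟧ u) : IsAlmostIntegral D (constantCoeff u.divXPowOrder) := by
  obtain ⟨r, hr, hru⟩ := h
  have hr0 : r ≠ 0 := nonZeroDivisors.ne_zero hr
  refine ⟨constantCoeff r.divXPowOrder, ?_, fun n => ?_⟩
  · rw [mem_nonZeroDivisors_iff_ne_zero, Ne, constantCoeff_divXPowOrder_eq_zero_iff]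
    exact hr0
  obtain ⟨f, hf⟩ := hru n
  have hf' : map (algebraMap D K) f = map (algebraMap D K) r * u ^ n := by
    rw [Algebra.smul_def] at hf
    exact hf
  have hr' : map (algebraMap D K) r = X ^ r.order.toNat * map (algebraMap D K) r.divXPowOrder := by
    conv_lhs => rw [← X_pow_order_mul_divXPowOrder (f := r)]
    simp
  have key : ∀ (m k : ℕ) (s w : K⟦X⟧), coeff (m + k * n) (X ^ m * s * (X ^ k * w) ^ n) =
      constantCoeff s * constantCoeff w ^ n := by
    intro m k s w
    rw [mul_pow, ← pow_mul, mul_mul_mul_comm, ← pow_add]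
    have := coeff_X_pow_mul (s * w ^ n) (m + k * n) 0
    rw [zero_add] at this
    rw [this]
    simp
  have := key r.order.toNat u.order.toNat (map (algebraMap D K) r.divXPowOrder) u.divXPowOrder
  rw [← hr', X_pow_order_mul_divXPowOrder, ← hf', coeff_map,
    ← coeff_zero_eq_constantCoeff_apply (map _ _), coeff_map, coeff_zero_eq_constantCoeff_apply] at this
  exact ⟨_, by rw [Algebra.smul_def]; exact this⟩

/-- An integral fraction lands in `K⟦X⟧`, which is integrally closed, and is almost integral over
`D⟦X⟧`. Subtracting the truncation already known to lie in `D⟦X⟧` turns its next nonzero coefficient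
into a lowest one. -/
theorem isIntegrallyClosed_powerSeries (K : Type*) [Field K] [Algebra D K] [IsFractionRing D K]
    (h : IsCompletelyIntegrallyClosed D K) : IsIntegrallyClosed D⟦X⟧ := by
  have hinj : Function.Injective (algebraMap D⟦X⟧ K⟦X⟧) :=
    PowerSeries.map_injective (algebraMap D K) (IsFractionRing.injective D K)
  have hrange : ∀ u : K⟦X⟧, IsAlmostIntegral D⟦X⟧ u → u ∈ (algebraMap D⟦X⟧ K⟦X⟧).range := by
    intro u hu
    have hcoeff : ∀ n, coeff n u ∈ (algebraMap D K).range := by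
      intro n
      induction n using Nat.strong_induction_on with
      | _ n ih =>
        have htr : ∀ i, ∃ c, algebraMap D K c = if i < n then coeff i u else 0 := by
          intro i
          split_ifs with hi
          · exact ih i hi
          · exact ⟨0, map_zero _⟩
        choose c hc using htr
        set v := u - algebraMap D⟦X⟧ K⟦X⟧ (mk c) with hv
        have hvco : ∀ i, coeff i v = if i < n then 0 else coeff i u := by
          intro i
          rw [hv, map_sub, show algebraMap D⟦X⟧ K⟦X⟧ (mk c) = map (algebraMap D K) (mk c) from rfl,
            coeff_map, coeff_mk, hc]
          split_ifs <;> simp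
        have hvi : IsAlmostIntegral D⟦X⟧ v :=
          (completeIntegralClosure D⟦X⟧ K⟦X⟧).sub_mem hu
            ((completeIntegralClosure D⟦X⟧ K⟦X⟧).algebraMap_mem _)
        by_cases h0 : coeff n u = 0
        · rw [h0]
          exact zero_mem _
        have hord : v.order = n := by
          rw [order_eq_nat]
          refine ⟨by rwa [hvco, if_neg (lt_irrefl n)], fun i hi => by rw [hvco, if_pos hi]⟩
        have := h _ (isAlmostIntegral_constantCoeff_divXPowOrder hvi)
        rwa [constantCoeff_divXPowOrder, hord, ENat.toNat_natCast, hvco, if_neg (lt_irrefl n)] at this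
    choose c hc using hcoeff
    exact ⟨mk c, PowerSeries.ext fun n => by
      rw [show algebraMap D⟦X⟧ K⟦X⟧ (mk c) = map (algebraMap D K) (mk c) from rfl,
        coeff_map, coeff_mk, hc]⟩
  rw [isIntegrallyClosed_iff (FractionRing D⟦X⟧)]
  intro x hx
  set L := FractionRing K⟦X⟧
  have hinjL : Function.Injective ((algebraMap K⟦X⟧ L).comp (algebraMap D⟦X⟧ K⟦X⟧)) :=
    (IsFractionRing.injective K⟦X⟧ L).comp hinj
  set φ : FractionRing D⟦X⟧ →+* L := IsFractionRing.lift hinjL with hφ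
  have hφa : ∀ f : D⟦X⟧, φ (algebraMap _ _ f) = algebraMap K⟦X⟧ L (algebraMap D⟦X⟧ K⟦X⟧ f) :=
    fun f => IsFractionRing.lift_algebraMap hinjL f
  have hint : IsIntegral K⟦X⟧ (φ x) :=
    hx.map_of_comp_eq (algebraMap D⟦X⟧ K⟦X⟧) φ (RingHom.ext fun f => (hφa f).symm)
  obtain ⟨u, hu⟩ := IsIntegrallyClosed.isIntegral_iff.1 hint
  obtain ⟨r, hr, hrx⟩ := hx.isAlmostIntegral
  have hua : IsAlmostIntegral D⟦X⟧ u := by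
    refine ⟨r, hr, fun n => ?_⟩
    obtain ⟨f, hf⟩ := hrx n
    refine ⟨f, IsFractionRing.injective K⟦X⟧ L ?_⟩
    rw [← hφa, hf, Algebra.smul_def, Algebra.smul_def, map_mul, map_mul, map_pow, map_pow, hφa, hu]
  obtain ⟨f, hf⟩ := hrange u hua
  exact ⟨f, φ.injective (by rw [hφa, hf, hu])⟩

/-- If all powers of `a` divide `b ≠ 0`, the root `∑ Cₙ X ^ (n + 1) / a ^ (2 * n + 1)` of `T² - aT +
X`, with `Cₙ` the Catalan numbers, has common denominator `b`. It is integral, hence in `D⟦X⟧`, and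
its coefficient of `X` is `1 / a`. -/
theorem isArchimedean_of_isIntegrallyClosed_powerSeries (h : IsIntegrallyClosed D⟦X⟧) :
    IsArchimedean D := by
  intro a ha
  rw [eq_bot_iff]
  intro b hb
  by_contra hb0
  replace hb0 : b ≠ 0 := hb0
  have hdvd : ∀ n, a ^ (n + 1) ∣ b := fun n =>
    Ideal.mem_span_singleton.1 ((Submodule.mem_iInf _).1 hb n)
  choose c hc using hdvd
  have ha0 : a ≠ 0 := by
    rintro rfl
    exact hb0 (by rw [hc 0]; simp)
  -- Formally `c n = b / a ^ (n + 1)`; this is what lets the Catalan recursion yield `hquad`.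
  have hcc : ∀ i j, c (2 * i) * c (2 * j) = a * b * c (2 * (i + j + 1)) := by
    intro i j
    apply mul_left_cancel₀ (pow_ne_zero (2 * i + 1 + (2 * j + 1)) ha0)
    calc a ^ (2 * i + 1 + (2 * j + 1)) * (c (2 * i) * c (2 * j))
        = (a ^ (2 * i + 1) * c (2 * i)) * (a ^ (2 * j + 1) * c (2 * j)) := by ring
      _ = b * b := by rw [← hc, ← hc]
      _ = b * (a ^ (2 * (i + j + 1) + 1) * c (2 * (i + j + 1))) := by rw [← hc]
      _ = _ := by ring
  set g : D⟦X⟧ := mk fun n => c (2 * n) * (catalan n : D) with hg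
  have hquad : X * g ^ 2 + C b ^ 2 = C (a * b) * g := by
    ext n
    cases n with
    | zero =>
      have := hc 0
      rw [zero_add, pow_one] at this
      simp only [hg, ← map_pow, map_add, coeff_C_mul, coeff_zero_X_mul, coeff_zero_C, coeff_mk,
        catalan_zero, mul_zero, Nat.cast_one, mul_one, zero_add]
      linear_combination b * this
    | succ n =>
      rw [map_add, coeff_succ_X_mul, ← map_pow, coeff_succ_C, add_zero, coeff_C_mul, sq, coeff_mul,
        hg, coeff_mk, catalan_succ', Nat.cast_sum, Finset.mul_sum, Finset.mul_sum]
      refine Finset.sum_congr rfl fun p hp => ?_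
      rw [coeff_mk, coeff_mk, Nat.cast_mul, ← Finset.HasAntidiagonal.mem_antidiagonal.1 hp]
      linear_combination (catalan p.1 : D) * (catalan p.2 : D) * hcc p.1 p.2
  set ι := algebraMap D⟦X⟧ (FractionRing D⟦X⟧)
  have hι : Function.Injective ι := IsFractionRing.injective _ _
  have hb1 : ι (C b) ≠ 0 := by
    rw [Ne, map_eq_zero_iff ι hι, map_eq_zero_iff _ C_injective]
    exact hb0
  have hint : IsIntegral D⟦X⟧ (ι (X * g) / ι (C b)) := by
    refine ⟨Polynomial.X ^ 2 - Polynomial.C (C a) * Polynomial.X + Polynomial.C X, ?_, ?_⟩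
    · monicity!
    · have := congrArg ι hquad
      simp only [map_add, map_mul, map_pow] at this
      simp only [Polynomial.eval₂_add, Polynomial.eval₂_sub, Polynomial.eval₂_mul,
        Polynomial.eval₂_X_pow, Polynomial.eval₂_C, Polynomial.eval₂_X, map_mul]
      change (ι X * ι g / ι (C b)) ^ 2 - ι (C a) * (ι X * ι g / ι (C b)) + ι X = 0
      field_simp
      linear_combination ι X * this
  obtain ⟨f, hf⟩ := IsIntegrallyClosed.isIntegral_iff.1 hint
  have hfg : C b * f = X * g := hι (by
    rw [map_mul, show ι f = _ from hf]
    field_simp)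
  have h1 : b * coeff 1 f = c 0 := by
    have := congrArg (coeff 1) hfg
    rw [coeff_C_mul, ← zero_add 1, coeff_succ_X_mul, hg, coeff_mk] at this
    simpa using this
  have h0 := hc 0
  rw [zero_add, pow_one, ← h1] at h0
  refine ha (IsUnit.of_mul_eq_one (coeff 1 f) (mul_left_cancel₀ hb0 ?_))
  linear_combination -h0

end PowerSeries

/-! ### Height-one radicals, the Archimedean property and rigid elements. -/

section HeightOne

variable {D : Type*} [CommRing D] [IsDomain D]

theorem eq_of_le_of_height_eq_one {P Q : Ideal D} [hP : P.IsPrime] [Q.IsPrime] (hP0 : P ≠ ⊥)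
    (hQ : Q.height = 1) (h : P ≤ Q) : P = Q := by
  by_contra hne
  have hlt := (Ideal.height_le_iff (n := 1)).1 hQ.le P hP (lt_of_le_of_ne h hne)
  rw [Nat.cast_one, Order.lt_one_iff, Ideal.height_eq_zero_iff_eq_bot] at hlt
  exact hP0 hlt

theorem height_eq_one_of_forall_lt {P : Ideal D} [P.IsPrime] (hP : P ≠ ⊥)
    (h : ∀ Q : Ideal D, Q.IsPrime → Q < P → Q = ⊥) : P.height = 1 := by
  apply le_antisymm
  · rw [← Nat.cast_one, Ideal.height_le_iff]
    intro Q hQ hlt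
    rw [h Q hQ hlt, Ideal.height_bot]
    exact one_pos
  · rw [Order.one_le_iff_ne_zero, Ne, Ideal.height_eq_zero_iff_eq_bot]
    exact hP

theorem IsPacketGenerator.radical_eq_of_mem {p q : D} (hp : IsPacketGenerator p)
    (hq : IsPacketGenerator q) (hq1 : (Ideal.span {q}).radical.height = 1)
    (h : p ∈ (Ideal.span {q}).radical) : (Ideal.span {p}).radical = (Ideal.span {q}).radical :=
  have := hp.isPrime
  have := hq.isPrime
  eq_of_le_of_height_eq_one hp.radical_ne_bot hq1 (radical_span_singleton_le hq.isPrime h)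

theorem height_radical_eq_one_of_isArchimedean [GCDMonoid D]
    (hfac : ∀ x : D, x ≠ 0 → ¬ IsUnit x →
      ∃ l : Multiset D, (∀ p ∈ l, IsPacketGenerator p) ∧ l.prod = x)
    (h : IsArchimedean D) {p : D} (hp : IsPacketGenerator p) :
    (Ideal.span {p}).radical.height = 1 := by
  have := hp.isPrime
  refine height_eq_one_of_forall_lt hp.radical_ne_bot fun Q hQ hlt => ?_
  rw [eq_bot_iff]
  intro y hy
  have hpQ : p ∉ Q := fun hpQ => hlt.not_ge (radical_span_singleton_le hQ hpQ)
  by_contra hy0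
  replace hy0 : y ≠ 0 := hy0
  have hdvd : ∀ n : ℕ, p ^ n ∣ y := by
    intro n
    -- If `u` is a nonunit, a packet generator `q ∣ u` has `√(q) ⊇ √(p) ⊇ Q`. As `p ∉ Q` forces `w ∈
    -- Q`, the coprime `u` and `w` both lie in `√(q)`.
    obtain ⟨u, w, hu, hw, huw⟩ := extract_gcd (p ^ n) y
    by_cases hunit : IsUnit u
    · rw [hu, mul_comm]
      exact (hunit.mul_left_dvd.2 (gcd_dvd_right _ _))
    exfalso
    have hu0 : u ≠ 0 := by
      rintro rfl
      exact pow_ne_zero n hp.ne_zero (by rw [hu, mul_zero])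
    obtain ⟨q, hq, hqu⟩ := exists_isPacketGenerator_dvd hfac hu0 hunit
    have hqrad := self_mem_radical_span_singleton q
    have hwQ : w ∈ Q := by
      rw [hw] at hy
      refine (hQ.mem_or_mem hy).resolve_left fun hg => hpQ ?_
      exact hQ.mem_of_pow_mem n (Ideal.mem_of_dvd Q (gcd_dvd_left _ _) hg)
    have huq := Ideal.mem_of_dvd _ hqu hqrad
    have hpq : p ∈ (Ideal.span {q}).radical := hq.isPrime.mem_of_pow_mem n (by
      rw [hu]
      exact Ideal.mul_mem_left _ _ huq)
    exact hq.not_isUnit_gcd huq (radical_span_singleton_le hq.isPrime hpq (hlt.le hwQ)) huw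
  have hbot := h p hp.not_isUnit
  exact hy0 (Ideal.mem_bot.1 (hbot ▸ (Submodule.mem_iInf _).2 fun n =>
    Ideal.mem_span_singleton.2 (hdvd (n + 1))))

/-- By height one, every nonunit divisor of `p` lies in `√(p)`, so the coprime cofactors of `gcd s
t` cannot both be nonunits. -/
theorem IsPacketGenerator.isRigid [GCDMonoid D]
    (hfac : ∀ x : D, x ≠ 0 → ¬ IsUnit x →
      ∃ l : Multiset D, (∀ p ∈ l, IsPacketGenerator p) ∧ l.prod = x)
    (hht : ∀ p : D, IsPacketGenerator p → (Ideal.span {p}).radical.height = 1) {p : D}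
    (hp : IsPacketGenerator p) : IsRigid p := by
  refine ⟨hp.ne_zero, hp.not_isUnit, fun s t hs ht => ?_⟩
  obtain ⟨u, w, hu, hw, huw⟩ := extract_gcd s t
  have hs0 : s ≠ 0 := ne_zero_of_dvd_ne_zero hp.ne_zero hs
  have ht0 : t ≠ 0 := ne_zero_of_dvd_ne_zero hp.ne_zero ht
  have hmem : ∀ v : D, v ∣ p → ¬ IsUnit v → v ∈ (Ideal.span {p}).radical := by
    intro v hv hv'
    obtain ⟨q, hq, hqv⟩ := exists_isPacketGenerator_dvd hfac
      (ne_zero_of_dvd_ne_zero hp.ne_zero hv) hv'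
    rw [hp.radical_eq_of_mem hq (hht q hq)
      (Ideal.mem_of_dvd _ (hqv.trans hv) (self_mem_radical_span_singleton q))]
    exact Ideal.mem_of_dvd _ hqv (self_mem_radical_span_singleton q)
  by_cases hu' : IsUnit u
  · left
    rw [hu, mul_comm]
    exact hu'.mul_left_dvd.2 (gcd_dvd_right _ _)
  by_cases hw' : IsUnit w
  · right
    rw [hw, mul_comm]
    exact hw'.mul_left_dvd.2 (gcd_dvd_left _ _)
  exact absurd huw (hp.not_isUnit_gcd (hmem u ((Dvd.intro_left _ hu.symm).trans hs) hu')
    (hmem w ((Dvd.intro_left _ hw.symm).trans ht) hw'))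

theorem isGUFD_of_height_radical_eq_one [GCDMonoid D]
    (hfac : ∀ x : D, x ≠ 0 → ¬ IsUnit x →
      ∃ l : Multiset D, (∀ p ∈ l, IsPacketGenerator p) ∧ l.prod = x)
    (hht : ∀ p : D, IsPacketGenerator p → (Ideal.span {p}).radical.height = 1) : IsGUFD D where
  isGCDMonoid := inferInstance
  exists_rigid_factorization x hx hx' := by
    obtain ⟨l, hl, h⟩ := hfac x hx hx'
    exact ⟨l, fun p hp => (hl p hp).isRigid hfac hht, h⟩
  dvd_pow_of_rigid r hr s hs hs' := by
    obtain ⟨l, hl, rfl⟩ := hfac r hr.1 hr.2.1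
    obtain ⟨q, hq, hqs⟩ := exists_isPacketGenerator_dvd hfac (ne_zero_of_dvd_ne_zero hr.1 hs) hs'
    -- Rigidity of `r` makes `p` and `q` comparable, and height one then identifies their radicals.
    have hrad : ∀ p ∈ l, (Ideal.span {p}).radical = (Ideal.span {q}).radical := by
      intro p hp
      rcases hr.2.2 p q (Multiset.dvd_prod hp) (hqs.trans hs) with h | h
      · exact (hq.radical_eq_of_mem (hl p hp) (hht p (hl p hp))
          (Ideal.mem_of_dvd _ h (self_mem_radical_span_singleton p))).symm
      · exact (hl p hp).radical_eq_of_mem hq (hht q hq)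
          (Ideal.mem_of_dvd _ h (self_mem_radical_span_singleton q))
    have hpow : ∀ m : Multiset D, (∀ p ∈ m, p ∈ l) → ∃ n : ℕ, m.prod ∣ s ^ n := by
      intro m
      induction m using Multiset.induction_on with
      | empty => exact fun _ => ⟨0, by simp⟩
      | cons p m ih =>
        intro hm
        obtain ⟨n, hn⟩ := ih fun p' hp' => hm p' (Multiset.mem_cons_of_mem hp')
        obtain ⟨k, hk⟩ := mem_radical_span_singleton.1 <|
          hrad p (hm p (Multiset.mem_cons_self p m)) ▸ self_mem_radical_span_singleton q
        refine ⟨k + n, ?_⟩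
        rw [Multiset.prod_cons, pow_add]
        exact mul_dvd_mul (hk.trans (pow_dvd_pow_of_dvd hqs k)) hn
    obtain ⟨n, hn⟩ := hpow l fun _ => id
    exact ⟨n + 1, Nat.le_add_left _ _, hn.trans (pow_dvd_pow s n.le_succ)⟩

/-- A rigid factor `r ∈ √(p)` of `p` and a rigid `q` in a nonzero prime `Q < √(p)` have a nonunit
gcd, so `q` divides a power of `r`. This puts `r`, hence `p`, in `Q`. -/
theorem IsGUFD.height_radical_eq_one [GCDMonoid D] (h : IsGUFD D) {p : D}
    (hp : IsPacketGenerator p) : (Ideal.span {p}).radical.height = 1 := by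
  have := hp.isPrime
  obtain ⟨l, hl, hlp⟩ := h.exists_rigid_factorization p hp.ne_zero hp.not_isUnit
  obtain ⟨r, hr, hrp⟩ := (hp.isPrime.multiset_prod_mem_iff_exists_mem l).1
    (hlp ▸ self_mem_radical_span_singleton p)
  refine height_eq_one_of_forall_lt hp.radical_ne_bot fun Q hQ hlt => ?_
  by_contra hQ0
  obtain ⟨y, hy, hy0⟩ := Submodule.exists_mem_ne_zero_of_ne_bot hQ0
  obtain ⟨m, hm, hmy⟩ := h.exists_rigid_factorization y hy0
    fun hu => hQ.ne_top (Ideal.eq_top_of_isUnit_mem _ hy hu)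
  obtain ⟨q, hq, hqQ⟩ := (hQ.multiset_prod_mem_iff_exists_mem m).1 (hmy ▸ hy)
  have hg := hp.not_isUnit_gcd hrp (hlt.le hqQ)
  obtain ⟨n, -, hn⟩ := h.dvd_pow_of_rigid q (hm q hq) _ (gcd_dvd_right r q) hg
  have hrQ : r ∈ Q := hQ.mem_of_pow_mem n
    (Ideal.mem_of_dvd Q (hn.trans (pow_dvd_pow_of_dvd (gcd_dvd_left r q) n)) hqQ)
  exact hlt.not_ge (radical_span_singleton_le hQ
    (Ideal.mem_of_dvd Q (hlp ▸ Multiset.dvd_prod hr) hrQ))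

end HeightOne

/-! ### Rank-one valuation rings and their intersections. -/

section Valuation

variable {D : Type*} [CommRing D] [IsDomain D]
variable {K : Type*} [Field K] [Algebra D K] [IsFractionRing D K]

/-- In a one-dimensional local domain, a nonunit `y` has a power in every nonzero principal
ideal. -/
theorem exists_dvd_pow_of_ringKrullDim_eq_one {V : Type*} [CommRing V] [IsDomain V]
    [IsLocalRing V] (hV : ringKrullDim V = 1) {y r : V} (hy : ¬ IsUnit y) (hr : r ≠ 0) :
    ∃ n : ℕ, r ∣ y ^ n := by
  have : Ring.KrullDimLE 1 V := (Order.krullDimLE_iff 1 _).2 (by exact_mod_cast hV.le)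
  rw [← mem_radical_span_singleton, Ideal.radical_eq_sInf, Submodule.mem_sInf]
  rintro (P : Ideal V) ⟨hP, hPp⟩
  have hP0 : P ≠ ⊥ := by
    rintro rfl
    exact hr (by simpa using hP)
  have hPm : P.IsMaximal := hPp.isMaximal_of_ne_bot hP0
  rw [IsLocalRing.eq_maximalIdeal hPm]
  exact hy

/-- If `x ∉ V`, then `x⁻¹` is a nonunit of `V`, so `x⁻¹ ^ n = r * c` for some `n` and some `c ∈ V`;
then `x = r * x ^ (n + 1) * c ∈ V`. -/
theorem mem_valuationSubring_of_forall_mul_pow_mem {V : ValuationSubring K}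
    (hV : ringKrullDim V = 1) {x r : K} (hr : r ≠ 0) (h : ∀ n : ℕ, r * x ^ n ∈ V) : x ∈ V := by
  by_contra hx
  have hx0 : x ≠ 0 := by
    rintro rfl
    exact hx V.zero_mem
  have hy : x⁻¹ ∈ V := (V.mem_or_inv_mem x).resolve_left hx
  have hyu : ¬ IsUnit (⟨x⁻¹, hy⟩ : V) := by
    intro hu
    obtain ⟨z, hz⟩ := hu.exists_right_inv
    have hz' : x⁻¹ * (z : K) = 1 := congrArg Subtype.val hz
    apply hx
    rw [show x = z by field_simp at hz'; exact hz'.symm]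
    exact z.2
  have hrV : r ∈ V := by simpa using h 0
  obtain ⟨n, c, hc⟩ := exists_dvd_pow_of_ringKrullDim_eq_one hV hyu
    (r := ⟨r, hrV⟩) (fun h => hr (congrArg Subtype.val h))
  have hc' : x⁻¹ ^ n = r * (c : K) := congrArg Subtype.val hc
  apply hx
  have : x = r * x ^ (n + 1) * c := by
    rw [mul_right_comm, ← hc', pow_succ, inv_pow, ← mul_assoc, inv_mul_cancel₀ (pow_ne_zero n hx0),
      one_mul]
  rw [this]
  exact V.mul_mem _ _ (h (n + 1)) c.2

theorem IsIntersectionOfRankOneValuationDomains.isCompletelyIntegrallyClosed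
    (h : IsIntersectionOfRankOneValuationDomains D K) : IsCompletelyIntegrallyClosed D K := by
  obtain ⟨S, hS, hmem⟩ := h
  rintro x ⟨r, hr, hrx⟩
  refine (hmem x).2 fun V hV => mem_valuationSubring_of_forall_mul_pow_mem (hS V hV)
    (r := algebraMap D K r) (by simpa using nonZeroDivisors.ne_zero hr) fun n => ?_
  rw [← Algebra.smul_def]
  exact (hmem _).1 (hrx n) V hV

theorem exists_isUnit_gcd_div_eq (D : Type*) [CommRing D] [IsDomain D] [Algebra D K]
    [IsFractionRing D K] [GCDMonoid D] (x : K) :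
    ∃ a b : D, b ≠ 0 ∧ IsUnit (gcd a b) ∧ x = algebraMap D K a / algebraMap D K b := by
  obtain ⟨m, n, hn, rfl⟩ := IsFractionRing.div_surjective D x
  obtain ⟨a, b, ha, hb, hab⟩ := extract_gcd m n
  have hn0 : n ≠ 0 := nonZeroDivisors.ne_zero hn
  have hg : gcd m n ≠ 0 := fun h => hn0 (by rw [hb, h, zero_mul])
  have hb0 : b ≠ 0 := fun h => hn0 (by rw [hb, h, mul_zero])
  refine ⟨a, b, hb0, hab, ?_⟩
  have hg' : algebraMap D K (gcd m n) ≠ 0 := by simpa using hg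
  rw [← mul_div_mul_left (algebraMap D K a) _ hg', ← map_mul, ← map_mul, ← ha, ← hb]

/-- The localization of a GCD domain at the radical of a packet, as a valuation ring. -/
def IsPacketGenerator.valuationSubring (K : Type*) [Field K] [Algebra D K] [IsFractionRing D K]
    [GCDMonoid D] {p : D} (hp : IsPacketGenerator p) : ValuationSubring K :=
  have := hp.isPrime
  { (Localization.subalgebra.ofField K (Ideal.span {p}).radical.primeCompl
      (Ideal.primeCompl_le_nonZeroDivisors _)).toSubring with
    mem_or_inv_mem' := by
      intro x
      obtain ⟨a, b, hb, hab, rfl⟩ := exists_isUnit_gcd_div_eq D x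
      by_cases hbp : b ∈ (Ideal.span {p}).radical
      · have hap : a ∉ (Ideal.span {p}).radical := fun hap => hp.not_isUnit_gcd hap hbp hab
        exact Or.inr ⟨b, a, hap, by rw [inv_div, div_eq_mul_inv]⟩
      · exact Or.inl ⟨a, b, hbp, by rw [div_eq_mul_inv]⟩ }

theorem IsPacketGenerator.mem_valuationSubring [GCDMonoid D] {p : D} (hp : IsPacketGenerator p)
    {x : K} : x ∈ hp.valuationSubring K ↔ ∃ a s : D, s ∉ (Ideal.span {p}).radical ∧
      x = algebraMap D K a / algebraMap D K s := by
  simp only [div_eq_mul_inv]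
  constructor
  · rintro ⟨a, s, hs, rfl⟩
    exact ⟨a, s, hs, rfl⟩
  · rintro ⟨a, s, hs, rfl⟩
    exact ⟨a, s, hs, rfl⟩

theorem IsPacketGenerator.ringKrullDim_valuationSubring [GCDMonoid D] {p : D}
    (hp : IsPacketGenerator p) :
    ringKrullDim (hp.valuationSubring K) = (Ideal.span {p}).radical.height :=
  have := hp.isPrime
  IsLocalization.AtPrime.ringKrullDim_eq_height (Ideal.span {p}).radical
    (Localization.subalgebra.ofField K (Ideal.span {p}).radical.primeCompl
      (Ideal.primeCompl_le_nonZeroDivisors _))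

theorem isIntersectionOfRankOneValuationDomains_of_height_radical_eq_one [GCDMonoid D]
    (hfac : ∀ x : D, x ≠ 0 → ¬ IsUnit x →
      ∃ l : Multiset D, (∀ p ∈ l, IsPacketGenerator p) ∧ l.prod = x)
    (hht : ∀ p : D, IsPacketGenerator p → (Ideal.span {p}).radical.height = 1) :
    IsIntersectionOfRankOneValuationDomains D K := by
  refine ⟨{V | ∃ (p : D) (hp : IsPacketGenerator p), V = hp.valuationSubring K}, ?_, fun x =>
    ⟨?_, fun h => ?_⟩⟩
  · rintro _ ⟨p, hp, rfl⟩
    rw [hp.ringKrullDim_valuationSubring, hht p hp]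
    rfl
  · rintro ⟨a, rfl⟩ _ ⟨p, hp, rfl⟩
    refine hp.mem_valuationSubring.2 ⟨a, 1, fun h1 => hp.isPrime.ne_top
      ((Ideal.eq_top_iff_one _).2 h1), by simp⟩
  · obtain ⟨a, b, hb, hab, rfl⟩ := exists_isUnit_gcd_div_eq D x
    have hb' : algebraMap D K b ≠ 0 := by simpa using hb
    by_cases hbu : IsUnit b
    · obtain ⟨c, hc⟩ := hbu.exists_right_inv
      refine ⟨a * c, ?_⟩
      rw [eq_div_iff hb', ← map_mul, mul_assoc, mul_comm c, hc, mul_one]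
    exfalso
    -- A packet generator `p` dividing the reduced denominator `b` also divides every denominator of
    -- `a / b`, so `a / b` is not in the localization at `√(p)`.
    obtain ⟨p, hp, hpb⟩ := exists_isPacketGenerator_dvd hfac hb hbu
    obtain ⟨c, s, hs, hcs⟩ := hp.mem_valuationSubring.1 (h _ ⟨p, hp, rfl⟩)
    have hs' : algebraMap D K s ≠ 0 := by
      simp only [ne_eq, FaithfulSMul.algebraMap_eq_zero_iff]
      rintro rfl
      exact hs (zero_mem _)
    rw [div_eq_div_iff hb' hs', ← map_mul, ← map_mul] at hcs
    have hbs : b ∣ a * s := ⟨c, by rw [IsFractionRing.injective D K hcs, mul_comm]⟩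
    have hbs' : b ∣ s := by
      refine (gcd_isUnit_iff_isRelPrime.1 hab).symm.dvd_of_dvd_mul_left hbs
    exact hs (Ideal.mem_of_dvd _ (hpb.trans hbs') (self_mem_radical_span_singleton p))

end Valuation

end GCDURD

end

theorem theorem4p5 (D : Type*) [CommRing D] [IsDomain D]
    (K : Type*) [Field K] [Algebra D K] [IsFractionRing D K]
    (hGCD : IsGCDMonoid D) (hURD : GCDURD.IsURD D K) :
    List.TFAE
      [GCDURD.IsIntersectionOfRankOneValuationDomains D K,
       GCDURD.IsCompletelyIntegrallyClosed D K,
       IsIntegrallyClosed (PowerSeries D),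
       GCDURD.IsArchimedean D,
       ∀ I : Ideal D, GCDURD.IsPacket K I → ∃ P : Ideal D, P.IsPrime ∧ P.height = 1 ∧ I ≤ P,
       GCDURD.IsGUFD D] := by
  obtain ⟨hgcd⟩ := hGCD
  have hfac : ∀ x : D, x ≠ 0 → ¬ IsUnit x →
      ∃ l : Multiset D, (∀ p ∈ l, GCDURD.IsPacketGenerator p) ∧ l.prod = x :=
    fun x hx hx' => hURD.exists_multiset_isPacketGenerator hx hx'
  -- A height-one prime containing `p` contains the nonzero prime `√(p)`, hence equals it.
  have hheight : (∀ I : Ideal D, GCDURD.IsPacket K I →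
      ∃ P : Ideal D, P.IsPrime ∧ P.height = 1 ∧ I ≤ P) ↔
      ∀ p : D, GCDURD.IsPacketGenerator p → (Ideal.span {p}).radical.height = 1 := by
    constructor
    · intro h p hp
      obtain ⟨P, hP, hP1, hpP⟩ := h _ (hp.isPacket K)
      have := hp.isPrime
      rwa [GCDURD.eq_of_le_of_height_eq_one hp.radical_ne_bot hP1 (hP.radical_le_iff.2 hpP)]
    · intro h I hI
      obtain ⟨p, hp, rfl⟩ := hI.exists_eq_span_singleton
      exact ⟨_, hp.isPrime, h p hp, Ideal.le_radical⟩
  tfae_have 1 → 2 := fun h => h.isCompletelyIntegrallyClosed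
  tfae_have 2 → 3 := GCDURD.isIntegrallyClosed_powerSeries K
  tfae_have 3 → 4 := GCDURD.isArchimedean_of_isIntegrallyClosed_powerSeries
  tfae_have 4 → 5 := fun h => hheight.2 fun p hp =>
    GCDURD.height_radical_eq_one_of_isArchimedean hfac h hp
  tfae_have 5 → 6 := fun h => GCDURD.isGUFD_of_height_radical_eq_one hfac (hheight.1 h)
  tfae_have 6 → 5 := fun h => hheight.2 fun p hp => h.height_radical_eq_one hp
  tfae_have 5 → 1 := fun h =>
    GCDURD.isIntersectionOfRankOneValuationDomains_of_height_radical_eq_one hfac (hheight.1 h)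
  tfae_finish
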